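/- Let $G=(V(G),E(G))$ be a finite simple graph that is a tree with at least one edge, and let $k$ be a field. Let $S=k[s_e,t_e : e\in E(G)]$ be the standard graded polynomial ring in $2|E(G)|$ variables. For subsets $A,B\subseteq V(G)$ with $A\cup B=V(G)$ and $A\cap B=\emptyset$ (either may be empty), let $\mathrm{Cut}(A|B)$ be the set of edges of $G$ with one end in $A$ and the other in $B$, and let $$u_{A|B}=\prod_{e\in \mathrm{Cut}(A|B)}s_e\prod_{e\in E(G)\setminus \mathrm{Cut}(A|B)}t_e .$$ Let $I(G)\subseteq S$ be the monomial cut ideal of $G$, that is, the ideal generated by all the monomials $u_{A|B}$. Then (i) $\operatorname{reg}(S/I(G))=|E(G)|-1$, and (ii) $\operatorname{depth}(S/I(G))=|E(G)|-1$. Here $\operatorname{reg}(M)=\max\{j-i : \beta_{i,j}(M)\neq 0\}$ is the Castelnuovo–Mumford regularity, where $\beta_{i,j}(M)$ is the number of basis elements of degree $j$ in the $i$-th module of a minimal graded free resolution of $M$ over $S$, and $\operatorname{depth}(M)$ is the maximal length of an $M$-regular sequence contained in the ideal generated by all the variables of $S$. -/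

import Mathlib

noncomputable section

namespace MonomialCut

open MvPolynomial

section Depth

variable {R : Type*} [CommRing R]

/-- The depth of `M` with respect to the ideal `𝔪`: the supremum of the lengths of the
`M`-regular sequences contained in `𝔪`. -/
def depth (𝔪 : Ideal R) (M : Type*) [AddCommGroup M] [Module R M] : ℕ∞ :=
  ⨆ rs ∈ {rs : List R | (∀ r ∈ rs, r ∈ 𝔪) ∧ RingTheory.Sequence.IsRegular M rs}, (rs.length : ℕ∞)

end Depth

section Resolution

variable (σ k : Type*) [Field k]

/-- The homogeneous maximal ideal of the polynomial ring, generated by the variables. -/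
def irrelevantIdeal : Ideal (MvPolynomial σ k) :=
  Ideal.span (Set.range (X : σ → MvPolynomial σ k))

/-- The degree `n` part of the graded free module `⨁ c, S(-a c)`, whose `c`-th standard basis
vector has degree `a c`: all nonzero terms of the `c`-th coordinate have degree `n - a c`. -/
def twistedPart {p : ℕ} (a : Fin p → ℕ) (n : ℕ) : Set (Fin p → MvPolynomial σ k) :=
  {v | ∀ c, ∀ m ∈ (v c).support, m.degree + a c = n}

/-- A graded free resolution
`⋯ → F₂ → F₁ → F₀ → M → 0` of a module `M` over `S = k[x_i : i ∈ σ]`, graded by `𝓜`, where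
`F i = ⨁ b, S(-deg i b)` is a graded free module of finite rank `rank i` and all maps are
homogeneous of degree `0`. -/
structure GradedFreeResolution {M : Type*} [AddCommGroup M] [Module k M]
    [Module (MvPolynomial σ k) M] (𝓜 : ℕ → Submodule k M) where
  rank : ℕ → ℕ
  deg : (i : ℕ) → Fin (rank i) → ℕ
  d : (i : ℕ) →
    (Fin (rank (i + 1)) → MvPolynomial σ k) →ₗ[MvPolynomial σ k] (Fin (rank i) → MvPolynomial σ k)
  aug : (Fin (rank 0) → MvPolynomial σ k) →ₗ[MvPolynomial σ k] M
  d_graded : ∀ i n, ∀ v ∈ twistedPart σ k (deg (i + 1)) n, d i v ∈ twistedPart σ k (deg i) n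
  aug_graded : ∀ n, ∀ v ∈ twistedPart σ k (deg 0) n, aug v ∈ 𝓜 n
  exact : ∀ i, Function.Exact (d (i + 1)) (d i)
  aug_exact : Function.Exact (d 0) aug
  aug_surjective : Function.Surjective aug

variable {σ k} {M : Type*} [AddCommGroup M] [Module k M] [Module (MvPolynomial σ k) M]
  {𝓜 : ℕ → Submodule k M}

/-- A graded free resolution is minimal if the image of every differential
`F (i + 1) → F i` is contained in `𝔪 F i`. -/
def GradedFreeResolution.IsMinimal (F : GradedFreeResolution σ k 𝓜) : Prop :=
  ∀ i v c, F.d i v c ∈ irrelevantIdeal σ k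

/-- The number of basis elements of degree `j` in the `i`-th free module; for a minimal graded
free resolution this is the graded Betti number `β_{i,j}`. -/
def GradedFreeResolution.betti (F : GradedFreeResolution σ k 𝓜) (i j : ℕ) : ℕ :=
  Nat.card {b : Fin (F.rank i) // F.deg i b = j}

variable (σ) (𝓜) in
/-- `M`, graded by `𝓜`, has Castelnuovo–Mumford regularity `r`: a minimal graded free resolution
of `M` exists, and `r = max {j - i : β_{i,j} ≠ 0}`, where the graded Betti numbers `β_{i,j}` may be
computed from any minimal graded free resolution. -/
def HasRegularity (r : ℤ) : Prop :=
  (∃ F : GradedFreeResolution σ k 𝓜, F.IsMinimal) ∧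
    ∀ F : GradedFreeResolution σ k 𝓜, F.IsMinimal →
      IsGreatest {z : ℤ | ∃ i j : ℕ, F.betti i j ≠ 0 ∧ z = (j : ℤ) - (i : ℤ)} r

/-- The standard grading on `S ⧸ I`: the degree `n` part is the image of the forms of degree `n`. -/
def quotientGrading (I : Ideal (MvPolynomial σ k)) (n : ℕ) :
    Submodule k (MvPolynomial σ k ⧸ I) :=
  (homogeneousSubmodule σ k n).map (Ideal.Quotient.mkₐ k I).toLinearMap

end Resolution

section CutIdeal

variable {V : Type*} (G : SimpleGraph V)

/-- The edges of `G` with one end in `A` and the other one in `B`. -/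
def cut (A B : Set V) : Set G.edgeSet :=
  {e | ∃ i ∈ A, ∃ j ∈ B, (e : Sym2 V) = s(i, j)}

variable (k : Type*) [Field k] [Fintype G.edgeSet]

/-- The polynomial ring `k[s_e, t_e : e ∈ E(G)]`; the variable `s_e` is `X (Sum.inl e)` and
the variable `t_e` is `X (Sum.inr e)`. -/
abbrev CutRing : Type _ := MvPolynomial (G.edgeSet ⊕ G.edgeSet) k

open Classical in
/-- The monomial `u_{A|B}`, the product of the `s_e` over the edges in the cut and of the `t_e` over
the edges that are not in the cut. -/
def cutMonomial (A B : Set V) : CutRing G k :=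
  (∏ e : G.edgeSet with e ∈ cut G A B, X (Sum.inl e)) *
    ∏ e : G.edgeSet with e ∉ cut G A B, X (Sum.inr e)

/-- The monomial cut ideal `I(G)`, generated by the `u_{A|B}` for all partitions `A|B` of the vertex
set into two (possibly empty) parts. -/
def monomialCutIdeal : Ideal (CutRing G k) :=
  Ideal.span {u | ∃ A B : Set V, A ∪ B = Set.univ ∧ A ∩ B = ∅ ∧ u = cutMonomial G k A B}

end CutIdeal

end MonomialCut

end

/-! In a tree every set of edges is a cut, so the generators $u_{A|B}$ are all products choosing
$s_e$ or $t_e$ for each edge, and $I(G)=\prod_e (s_e,t_e)$ (`monomialCutIdeal_eq_edgeIdeal`). Both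
invariants come from adjoining one edge at a time: if $J$ is the product over the earlier edges and
$x,y$ are the two new variables, then $0\to J\to J\oplus J\to (x,y)J\to 0$ is exact, with first map
$(y,-x)$.

Regularity: the mapping cone of $(y,-x)$ on a linear resolution of $J$ is a linear resolution of
$(x,y)J$ (`LinearResolution.cone`), so $I(G)$ has a linear resolution starting in degree $n=|E(G)|$.
Since `HasRegularity` speaks of every minimal resolution, `IsMinimal.exists_deg_eq` shows that the
degrees occurring do not depend on the choice.

Depth: write $k$ also for the residue field $S/\mathfrak m$. As $x,y$ kill $k$, the map $(y,-x)$ is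
zero on $\mathrm{Ext}(k,-)$, so vanishing of $\mathrm{Ext}^j$ for $(x,y)J$ means vanishing of
$\mathrm{Ext}^j$ and $\mathrm{Ext}^{j+1}$ for $J$. After $n$ edges this concerns
$\mathrm{Ext}^{j},\dots,\mathrm{Ext}^{j+n}$ of $S$, whose first nonzero Ext is in degree $2n$. Hence
$\mathrm{Ext}^j(k,I(G))$ first survives at $j=n$, and that of $S/I(G)$ at $n-1$, which is the depth
by Rees' theorem. -/

namespace MonomialCut

open MvPolynomial

/-! ### Comparison of graded free resolutions; independence of the regularity from the resolution.
-/

section Comparison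

variable {σ k : Type*} [Field k]

lemma mem_twistedPart_iff {p : ℕ} {a : Fin p → ℕ} {n : ℕ} {v : Fin p → MvPolynomial σ k} :
    v ∈ twistedPart σ k a n ↔ ∀ c m, coeff m (v c) ≠ 0 → m.degree + a c = n := by
  simp [twistedPart]

lemma single_mem_twistedPart {p : ℕ} (a : Fin p → ℕ) (c : Fin p) :
    Pi.single c (1 : MvPolynomial σ k) ∈ twistedPart σ k a (a c) := by
  classical
  rw [mem_twistedPart_iff]
  intro c' m hm
  rcases eq_or_ne c' c with rfl | h
  · rw [Pi.single_eq_same, coeff_one] at hm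
    have : (0 : σ →₀ ℕ) = m := by by_contra h; simp [h] at hm
    simp [← this]
  · simp [Pi.single_eq_of_ne h] at hm

lemma smul_mem_twistedPart {p q : ℕ} {a : Fin p → ℕ} {b : Fin q → ℕ} {n : ℕ}
    {v : Fin p → MvPolynomial σ k} (hv : v ∈ twistedPart σ k a n) (c : Fin p)
    {w : Fin q → MvPolynomial σ k} (hw : w ∈ twistedPart σ k b (a c)) :
    v c • w ∈ twistedPart σ k b n := by
  classical
  intro c' m hm
  obtain ⟨m₁, h₁, m₂, h₂, rfl⟩ := Finset.mem_add.1 (support_mul _ _ hm)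
  have h₁ := hv c m₁ h₁
  have h₂ := hw c' m₂ h₂
  rw [map_add]
  omega

lemma sum_mem_twistedPart {p : ℕ} {a : Fin p → ℕ} {n : ℕ} {ι : Type*} (s : Finset ι)
    (v : ι → Fin p → MvPolynomial σ k) (hv : ∀ i ∈ s, v i ∈ twistedPart σ k a n) :
    ∑ i ∈ s, v i ∈ twistedPart σ k a n := by
  rw [mem_twistedPart_iff]
  intro c m hm
  rw [Finset.sum_apply, coeff_sum] at hm
  obtain ⟨i, hi, h⟩ := Finset.exists_ne_zero_of_sum_ne_zero hm
  exact mem_twistedPart_iff.1 (hv i hi) c m h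

/-- The component of degree `n` of an element of a graded free module. -/
noncomputable def twistedComponent {p : ℕ} (a : Fin p → ℕ) (n : ℕ) :
    (Fin p → MvPolynomial σ k) →+ (Fin p → MvPolynomial σ k) where
  toFun v c := if a c ≤ n then homogeneousComponent (n - a c) (v c) else 0
  map_zero' := by ext; simp
  map_add' v w := by
    funext c
    by_cases h : a c ≤ n <;> simp [h]

lemma coeff_twistedComponent {p : ℕ} (a : Fin p → ℕ) (n : ℕ) (v : Fin p → MvPolynomial σ k)
    (c : Fin p) (m : σ →₀ ℕ) :
    coeff m (twistedComponent a n v c) = if m.degree + a c = n then coeff m (v c) else 0 := by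
  change coeff m (if a c ≤ n then homogeneousComponent (n - a c) (v c) else 0) = _
  by_cases h : a c ≤ n
  · rw [if_pos h, coeff_homogeneousComponent]
    congr 1
    simp only [eq_iff_iff]
    omega
  · rw [if_neg h, if_neg (by omega), coeff_zero]

lemma twistedComponent_mem {p : ℕ} (a : Fin p → ℕ) (n : ℕ) (v : Fin p → MvPolynomial σ k) :
    twistedComponent a n v ∈ twistedPart σ k a n := by
  rw [mem_twistedPart_iff]
  intro c m hm
  rw [coeff_twistedComponent] at hm
  by_contra h
  exact hm (if_neg h)

lemma exists_sum_twistedComponent {p : ℕ} (a : Fin p → ℕ) (v : Fin p → MvPolynomial σ k) :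
    ∃ N, ∑ n ∈ Finset.range N, twistedComponent a n v = v := by
  -- A crude bound: the sum over all coordinates dominates the degree of each one.
  refine ⟨∑ c, ((v c).totalDegree + a c) + 1, ?_⟩
  funext c
  ext m
  rw [Finset.sum_apply, coeff_sum]
  simp only [coeff_twistedComponent]
  rw [Finset.sum_ite_eq]
  by_cases hm : coeff m (v c) = 0
  · simp [hm]
  · refine if_pos (Finset.mem_range.2 (Nat.lt_succ_of_le ?_))
    refine le_trans ?_ (Finset.single_le_sum (f := fun c ↦ (v c).totalDegree + a c)
      (fun _ _ ↦ Nat.zero_le _) (Finset.mem_univ c))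
    have := le_totalDegree (mem_support_iff.2 hm)
    exact Nat.add_le_add_right this _

/-- A family of subsets of an additive group is separated if there are additive maps that
restrict to the identity on one member and to zero on all others. -/
def HasProjections {M : Type*} [AddCommGroup M] (𝓜 : ℕ → Set M) : Prop :=
  ∀ n, ∃ π : M →+ M, (∀ m ∈ 𝓜 n, π m = m) ∧ ∀ j ≠ n, ∀ m ∈ 𝓜 j, π m = 0

lemma hasProjections_twistedPart {p : ℕ} (a : Fin p → ℕ) :
    HasProjections (twistedPart σ k a) := by
  refine fun n ↦ ⟨twistedComponent a n, fun v hv ↦ ?_, fun j hj v hv ↦ ?_⟩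
  all_goals
    rw [mem_twistedPart_iff] at hv
    funext c
    ext m
    rw [coeff_twistedComponent]
    have := hv c m
    by_cases h : coeff m (v c) = 0
    · simp [h]
    · have := this h
      simp_all

variable {M : Type*} [AddCommGroup M] [Module (MvPolynomial σ k) M]

/-- Since `f` is graded, the degree `n` component of `v` already maps to `f v`. This lets every lift
in the comparison theorem be chosen homogeneous. -/
lemma exists_mem_twistedPart_of_mem {p : ℕ} {a : Fin p → ℕ} {𝓜 : ℕ → Set M}
    (h𝓜 : HasProjections 𝓜) (f : (Fin p → MvPolynomial σ k) →ₗ[MvPolynomial σ k] M)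
    (hf : ∀ n, ∀ v ∈ twistedPart σ k a n, f v ∈ 𝓜 n) {n : ℕ} (v : Fin p → MvPolynomial σ k)
    (hv : f v ∈ 𝓜 n) : ∃ w ∈ twistedPart σ k a n, f w = f v := by
  obtain ⟨π, h₁, h₂⟩ := h𝓜 n
  obtain ⟨N, hN⟩ := exists_sum_twistedComponent a v
  refine ⟨if n < N then twistedComponent a n v else 0, ?_, ?_⟩
  · split_ifs
    · exact twistedComponent_mem a n v
    · rw [mem_twistedPart_iff]; simp
  · have h : π (f v) = f (if n < N then twistedComponent a n v else 0) := by
      conv_lhs => rw [← hN]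
      rw [map_sum, map_sum]
      have : ∀ j ∈ Finset.range N, π (f (twistedComponent a j v)) =
          if n = j then f (twistedComponent a n v) else 0 := by
        intro j _
        split_ifs with h
        · subst h; exact h₁ _ (hf _ _ (twistedComponent_mem a n v))
        · exact h₂ j (Ne.symm h) _ (hf _ _ (twistedComponent_mem a j v))
      rw [Finset.sum_congr rfl this, Finset.sum_ite_eq]
      simp only [Finset.mem_range]
      split_ifs <;> simp
    rw [← h, h₁ _ hv]

/-- Projectivity of a finite free module; `Q` carries a side condition on the images of the basis
vectors, in practice their degree. -/
lemma exists_lift {p : ℕ} {N : Type*} [AddCommGroup N] [Module (MvPolynomial σ k) N]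
    (g : N →ₗ[MvPolynomial σ k] M) (u : (Fin p → MvPolynomial σ k) →ₗ[MvPolynomial σ k] M)
    (Q : Fin p → N → Prop) (h : ∀ c, ∃ w, g w = u (Pi.single c 1) ∧ Q c w) :
    ∃ φ : (Fin p → MvPolynomial σ k) →ₗ[MvPolynomial σ k] N,
      (∀ v, g (φ v) = u v) ∧ ∀ c, Q c (φ (Pi.single c 1)) := by
  choose w hw hQ using h
  refine ⟨(Pi.basisFun (MvPolynomial σ k) (Fin p)).constr (MvPolynomial σ k) w, ?_, ?_⟩
  · intro v
    refine LinearMap.congr_fun (f := g ∘ₗ _) ((Pi.basisFun (MvPolynomial σ k) (Fin p)).ext ?_) v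
    intro c
    rw [LinearMap.comp_apply, Module.Basis.constr_basis, hw, Pi.basisFun_apply]
  · intro c
    have := (Pi.basisFun (MvPolynomial σ k) (Fin p)).constr_basis (MvPolynomial σ k) w c
    rw [Pi.basisFun_apply] at this
    rw [this]
    exact hQ c

lemma eq_sum_smul_single {p : ℕ} (v : Fin p → MvPolynomial σ k) :
    v = ∑ c, v c • Pi.single c (1 : MvPolynomial σ k) := by
  have := (Pi.basisFun (MvPolynomial σ k) (Fin p)).sum_repr v
  simpa using this.symm

lemma map_mem_twistedPart {p q : ℕ} {a : Fin p → ℕ} {b : Fin q → ℕ}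
    (φ : (Fin p → MvPolynomial σ k) →ₗ[MvPolynomial σ k] (Fin q → MvPolynomial σ k))
    (hφ : ∀ c, φ (Pi.single c 1) ∈ twistedPart σ k b (a c)) (n : ℕ)
    (v : Fin p → MvPolynomial σ k) (hv : v ∈ twistedPart σ k a n) :
    φ v ∈ twistedPart σ k b n := by
  rw [eq_sum_smul_single v, map_sum]
  simp only [map_smul]
  exact sum_mem_twistedPart _ _ fun c _ ↦ smul_mem_twistedPart hv c (hφ c)

lemma exists_dependent_seq {α : ℕ → Type*} (P : ∀ i, α i → Prop)
    (R : ∀ i, α i → α (i + 1) → Prop) (a : α 0) (ha : P 0 a)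
    (step : ∀ i a, P i a → ∃ b, P (i + 1) b ∧ R i a b) :
    ∃ s : ∀ i, α i, s 0 = a ∧ ∀ i, R i (s i) (s (i + 1)) := by
  choose f hf hR using step
  let s : ∀ i, {x : α i // P i x} :=
    fun i ↦ Nat.rec ⟨a, ha⟩ (fun i x ↦ ⟨f i x.1 x.2, hf i x.1 x.2⟩) i
  exact ⟨fun i ↦ (s i).1, rfl, fun i ↦ hR i (s i).1 (s i).2⟩

variable [Module k M] {𝓜 : ℕ → Submodule k M}

namespace GradedFreeResolution

/-- Two graded free resolutions of the same module admit a graded comparison map. -/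
lemma exists_comparison (h𝓜 : HasProjections fun n ↦ (𝓜 n : Set M))
    (F G : GradedFreeResolution σ k 𝓜) :
    ∃ φ : ∀ i, (Fin (F.rank i) → MvPolynomial σ k) →ₗ[MvPolynomial σ k]
        (Fin (G.rank i) → MvPolynomial σ k),
      (∀ v, G.aug (φ 0 v) = F.aug v) ∧ (∀ i v, G.d i (φ (i + 1) v) = φ i (F.d i v)) ∧
      ∀ i c, φ i (Pi.single c 1) ∈ twistedPart σ k (G.deg i) (F.deg i c) := by
  obtain ⟨φ₀, h₀, g₀⟩ := exists_lift G.aug F.aug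
    (fun c w ↦ w ∈ twistedPart σ k (G.deg 0) (F.deg 0 c)) (by
      intro c
      obtain ⟨w, hw⟩ := G.aug_surjective (F.aug (Pi.single c 1))
      obtain ⟨w', h₁, h₂⟩ := exists_mem_twistedPart_of_mem (n := F.deg 0 c) h𝓜 G.aug
        G.aug_graded w (by
          rw [hw]
          exact F.aug_graded _ _ (single_mem_twistedPart _ c))
      exact ⟨w', h₂.trans hw, h₁⟩)
  obtain ⟨φ, rfl, hφ⟩ := exists_dependent_seq
    (α := fun i ↦ (Fin (F.rank i) → MvPolynomial σ k) →ₗ[MvPolynomial σ k]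
      (Fin (G.rank i) → MvPolynomial σ k))
    -- The invariant pairs gradedness with the fact that `φ ∘ F.d i` lands in the image of `G.d i`,
    -- which is what the next lift needs.
    (fun i φ ↦ (∀ c, φ (Pi.single c 1) ∈ twistedPart σ k (G.deg i) (F.deg i c)) ∧
      ∀ v, φ (F.d i v) ∈ Set.range (G.d i))
    (fun i φ ψ ↦ (∀ v, G.d i (ψ v) = φ (F.d i v)) ∧
      ∀ c, ψ (Pi.single c 1) ∈ twistedPart σ k (G.deg (i + 1)) (F.deg (i + 1) c)) φ₀
    ⟨g₀, fun v ↦ by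
      rw [← G.aug_exact, h₀]
      exact (F.aug_exact _).2 ⟨v, rfl⟩⟩
    (by
      rintro i φ ⟨hφ, hr⟩
      obtain ⟨ψ, h₁, h₂⟩ := exists_lift (G.d i) (φ ∘ₗ F.d i)
        (fun c w ↦ w ∈ twistedPart σ k (G.deg (i + 1)) (F.deg (i + 1) c)) (by
          intro c
          obtain ⟨w, hw⟩ := hr (Pi.single c 1)
          obtain ⟨w', h₁, h₂⟩ := exists_mem_twistedPart_of_mem (n := F.deg (i + 1) c)
            (hasProjections_twistedPart _) (G.d i) (G.d_graded i) w (by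
              rw [hw]
              exact map_mem_twistedPart φ hφ _ _
                (F.d_graded _ _ _ (single_mem_twistedPart _ c)))
          exact ⟨w', h₂.trans hw, h₁⟩)
      refine ⟨ψ, ⟨h₂, fun v ↦ ?_⟩, h₁, h₂⟩
      rw [← G.exact i, h₁, LinearMap.comp_apply, (F.exact i _).2 ⟨v, rfl⟩, map_zero])
  refine ⟨φ, h₀, fun i ↦ (hφ i).1, fun i ↦ ?_⟩
  cases i with
  | zero => exact g₀
  | succ i => exact (hφ i).2

/-- An endomorphism of a free resolution that lifts zero is null-homotopic. -/
lemma exists_homotopy (F : GradedFreeResolution σ k 𝓜)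
    (θ : ∀ i, (Fin (F.rank i) → MvPolynomial σ k) →ₗ[MvPolynomial σ k]
        (Fin (F.rank i) → MvPolynomial σ k))
    (h₀ : ∀ v, F.aug (θ 0 v) = 0) (hθ : ∀ i v, F.d i (θ (i + 1) v) = θ i (F.d i v)) :
    ∃ h : ∀ i, (Fin (F.rank i) → MvPolynomial σ k) →ₗ[MvPolynomial σ k]
        (Fin (F.rank (i + 1)) → MvPolynomial σ k),
      (∀ v, F.d 0 (h 0 v) = θ 0 v) ∧
        ∀ i v, F.d (i + 1) (h (i + 1) v) + h i (F.d i v) = θ (i + 1) v := by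
  have dd : ∀ i v, F.d i (F.d (i + 1) v) = 0 := fun i v ↦ (F.exact i _).2 ⟨v, rfl⟩
  obtain ⟨s₀, hs₀, -⟩ := exists_lift (F.d 0) (θ 0) (fun _ _ ↦ True) (by
    intro c
    obtain ⟨w, hw⟩ := (F.aug_exact _).1 (h₀ (Pi.single c 1))
    exact ⟨w, hw, trivial⟩)
  obtain ⟨s, rfl, hs⟩ := exists_dependent_seq
    (α := fun i ↦ (Fin (F.rank i) → MvPolynomial σ k) →ₗ[MvPolynomial σ k]
      (Fin (F.rank (i + 1)) → MvPolynomial σ k))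
    -- This says that `θ (i + 1) - h ∘ F.d i` takes values in cycles, so that it lifts through `F.d
    -- (i + 1)`.
    (fun i h ↦ ∀ v, F.d i (h (F.d i v)) = F.d i (θ (i + 1) v))
    (fun i h h' ↦ ∀ v, F.d (i + 1) (h' v) + h (F.d i v) = θ (i + 1) v) s₀
    (fun v ↦ by rw [hs₀, hθ])
    (by
      intro i h hh
      obtain ⟨h', h₁, -⟩ := exists_lift (F.d (i + 1)) (θ (i + 1) - h ∘ₗ F.d i)
        (fun _ _ ↦ True) (by
          intro c
          obtain ⟨w, hw⟩ := (F.exact i ((θ (i + 1) - h ∘ₗ F.d i) (Pi.single c 1))).1 (by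
            rw [LinearMap.sub_apply, map_sub, LinearMap.comp_apply, hh, sub_self])
          exact ⟨w, hw, trivial⟩)
      refine ⟨h', fun v ↦ ?_, fun v ↦ ?_⟩
      · rw [h₁, LinearMap.sub_apply, LinearMap.comp_apply, dd, map_zero, sub_zero, ← hθ]
      · rw [h₁, LinearMap.sub_apply, LinearMap.comp_apply, sub_add_cancel])
  exact ⟨s, hs₀, hs⟩

end GradedFreeResolution

lemma map_apply_mem {p q : ℕ} (I : Ideal (MvPolynomial σ k))
    (φ : (Fin p → MvPolynomial σ k) →ₗ[MvPolynomial σ k] (Fin q → MvPolynomial σ k))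
    (v : Fin p → MvPolynomial σ k) (hv : ∀ c, v c ∈ I) (c : Fin q) : φ v c ∈ I := by
  rw [eq_sum_smul_single v, map_sum, Finset.sum_apply]
  refine I.sum_mem fun c' _ ↦ ?_
  rw [map_smul, Pi.smul_apply, smul_eq_mul]
  exact I.mul_mem_right _ (hv c')

lemma mem_irrelevantIdeal_iff {f : MvPolynomial σ k} :
    f ∈ irrelevantIdeal σ k ↔ coeff 0 f = 0 := by
  rw [irrelevantIdeal, ← Set.image_univ, mem_ideal_span_X_image]
  constructor
  · intro h
    by_contra h'
    obtain ⟨i, -, hi⟩ := h 0 (mem_support_iff.2 h')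
    exact hi rfl
  · intro h m hm
    by_contra! h'
    have : m = 0 := by ext i; exact h' i (Set.mem_univ i)
    subst this
    exact mem_support_iff.1 hm h

lemma one_notMem_irrelevantIdeal : (1 : MvPolynomial σ k) ∉ irrelevantIdeal σ k := by
  simp [mem_irrelevantIdeal_iff]

namespace GradedFreeResolution

/-- The composite `ψ ∘ φ` is homotopic to the identity, so by minimality it is the identity modulo
$\mathfrak m$. If no basis vector of `G` had the degree of `c`, then `φ` would send the basis vector
`c` into $\mathfrak m G_i$, forcing $1\in\mathfrak m$. Only degrees are compared, not
multiplicities, which suffices for the regularity. -/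
lemma IsMinimal.exists_deg_eq {F : GradedFreeResolution σ k 𝓜} (hF : F.IsMinimal)
    (h𝓜 : HasProjections fun n ↦ (𝓜 n : Set M)) (G : GradedFreeResolution σ k 𝓜) (i : ℕ)
    (c : Fin (F.rank i)) : ∃ c', G.deg i c' = F.deg i c := by
  obtain ⟨φ, φ₀, hφ, gφ⟩ := exists_comparison h𝓜 F G
  obtain ⟨ψ, ψ₀, hψ, -⟩ := exists_comparison h𝓜 G F
  obtain ⟨h, h₀, hh⟩ := F.exists_homotopy (fun i ↦ LinearMap.id - ψ i ∘ₗ φ i)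
    (fun v ↦ by simp [φ₀, ψ₀]) (fun i v ↦ by simp [hφ, hψ])
  have key : ∀ i v c, (v - ψ i (φ i v)) c ∈ irrelevantIdeal σ k := by
    intro i v c
    cases i with
    | zero =>
      have := h₀ v
      simp only [LinearMap.sub_apply, LinearMap.id_apply, LinearMap.comp_apply] at this
      rw [← this]
      exact hF _ _ _
    | succ i =>
      have := hh i v
      simp only [LinearMap.sub_apply, LinearMap.id_apply, LinearMap.comp_apply] at this
      rw [← this, Pi.add_apply]
      exact add_mem (hF _ _ _) (map_apply_mem _ _ _ (hF i v) c)
  by_contra! hne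
  have h₁ := key i (Pi.single c 1) c
  have h₂ : ψ i (φ i (Pi.single c 1)) c ∈ irrelevantIdeal σ k := by
    refine map_apply_mem _ _ _ (fun c' ↦ ?_) c
    rw [mem_irrelevantIdeal_iff]
    by_contra h'
    -- A nonzero constant term can only occur between basis elements of equal degree.
    have := mem_twistedPart_iff.1 (gφ i c) c' 0 h'
    simp only [map_zero, zero_add] at this
    exact hne c' this
  have h₃ := add_mem h₁ h₂
  rw [Pi.sub_apply, sub_add_cancel, Pi.single_eq_same] at h₃
  exact one_notMem_irrelevantIdeal h₃

lemma betti_ne_zero_iff (F : GradedFreeResolution σ k 𝓜) (i j : ℕ) :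
    F.betti i j ≠ 0 ↔ ∃ c, F.deg i c = j := by
  rw [betti, Nat.card_ne_zero, nonempty_subtype]
  exact and_iff_left inferInstance

/-- The regularity can be read off from a single minimal graded free resolution. -/
lemma IsMinimal.hasRegularity {F : GradedFreeResolution σ k 𝓜} (hF : F.IsMinimal)
    (h𝓜 : HasProjections fun n ↦ (𝓜 n : Set M)) {r : ℤ}
    (hr : IsGreatest {z : ℤ | ∃ i j : ℕ, F.betti i j ≠ 0 ∧ z = (j : ℤ) - (i : ℤ)} r) :
    HasRegularity σ 𝓜 r := by
  refine ⟨⟨F, hF⟩, fun G hG ↦ ?_⟩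
  have : ∀ i j, G.betti i j ≠ 0 ↔ F.betti i j ≠ 0 := by
    intro i j
    simp only [betti_ne_zero_iff]
    constructor
    · rintro ⟨c, rfl⟩
      exact hG.exists_deg_eq h𝓜 F i c
    · rintro ⟨c, rfl⟩
      exact hF.exists_deg_eq h𝓜 G i c
  simpa only [this] using hr

end GradedFreeResolution

end Comparison

end MonomialCut

namespace MonomialCut

open MvPolynomial

/-! ### Linear resolutions, their mapping cones and the regularity they give. -/

section LinearResolution

variable {σ k : Type*} [Field k]

/-- A linear free resolution of an ideal `J` generated in degree `q`: the differentials are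
given by matrices of linear forms, and the augmentation by forms of degree `q`. -/
structure LinearResolution (J : Ideal (MvPolynomial σ k)) (q : ℕ) where
  ι : ℕ → Type
  fintype : ∀ i, Fintype (ι i)
  d : ∀ i, (ι (i + 1) → MvPolynomial σ k) →ₗ[MvPolynomial σ k] (ι i → MvPolynomial σ k)
  aug : (ι 0 → MvPolynomial σ k) →ₗ[MvPolynomial σ k] MvPolynomial σ k
  d_hom : ∀ i n v, (∀ c, (v c).IsHomogeneous n) → ∀ c, (d i v c).IsHomogeneous (n + 1)
  aug_hom : ∀ n v, (∀ c, (v c).IsHomogeneous n) → (aug v).IsHomogeneous (n + q)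
  d_mem : ∀ i v c, d i v c ∈ irrelevantIdeal σ k
  exact : ∀ i v, d i v = 0 ↔ ∃ w, d (i + 1) w = v
  aug_exact : ∀ v, aug v = 0 ↔ ∃ w, d 0 w = v
  mem_iff : ∀ f, f ∈ J ↔ ∃ v, aug v = f

namespace LinearResolution

variable (σ k) in
/-- The resolution of the unit ideal. -/
noncomputable def unit : LinearResolution (⊤ : Ideal (MvPolynomial σ k)) 0 where
  ι i := PLift (i = 0)
  fintype i := inferInstance
  d i := 0
  aug := LinearMap.proj ⟨rfl⟩
  d_hom i n v _ c := isHomogeneous_zero _ _ _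
  aug_hom n v h := h _
  d_mem i v c := zero_mem _
  exact i v := by
    have : v = 0 := by funext c; exact absurd c.down (Nat.succ_ne_zero i)
    simp [this]
  aug_exact v := by
    constructor
    · intro h
      refine ⟨0, ?_⟩
      funext c
      exact h.symm
    · rintro ⟨w, rfl⟩
      rfl
  mem_iff f := by
    simp only [Submodule.mem_top, true_iff]
    exact ⟨fun _ ↦ f, rfl⟩

variable {J : Ideal (MvPolynomial σ k)} {q : ℕ} (R : LinearResolution J q)

/-- The index types of a resolution shifted by one homological degree. -/
def prevι : ℕ → Type
  | 0 => PEmpty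
  | i + 1 => R.ι i

/-- The differentials of a resolution shifted by one homological degree. -/
noncomputable def prevD : ∀ i, (R.ι i → MvPolynomial σ k) →ₗ[MvPolynomial σ k]
    (R.prevι i → MvPolynomial σ k)
  | 0 => 0
  | i + 1 => R.d i

/-- The index types of the mapping cone. -/
abbrev coneι (i : ℕ) : Type := (R.ι i ⊕ R.ι i) ⊕ R.prevι i

/-- The inclusion of the shifted summand. -/
def inrι (i : ℕ) : R.ι i → R.coneι (i + 1) := Sum.inr

/-- The differentials of the mapping cone of `(y, -x) : F → F × F`. -/
noncomputable def coneD (x y : MvPolynomial σ k) (i : ℕ) :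
    (R.coneι (i + 1) → MvPolynomial σ k) →ₗ[MvPolynomial σ k] (R.coneι i → MvPolynomial σ k) :=
  LinearMap.pi <| Sum.elim
    (Sum.elim
      (fun c ↦ LinearMap.proj c ∘ₗ (R.d i ∘ₗ LinearMap.funLeft _ _ (Sum.inl ∘ Sum.inl) +
        y • LinearMap.funLeft _ _ (R.inrι i)))
      (fun c ↦ LinearMap.proj c ∘ₗ (R.d i ∘ₗ LinearMap.funLeft _ _ (Sum.inl ∘ Sum.inr) -
        x • LinearMap.funLeft _ _ (R.inrι i))))
    (fun c ↦ LinearMap.proj c ∘ₗ (-(R.prevD i ∘ₗ LinearMap.funLeft _ _ (R.inrι i))))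

/-- The augmentation of the mapping cone. -/
noncomputable def coneAug (x y : MvPolynomial σ k) :
    (R.coneι 0 → MvPolynomial σ k) →ₗ[MvPolynomial σ k] MvPolynomial σ k :=
  x • (R.aug ∘ₗ LinearMap.funLeft _ _ (Sum.inl ∘ Sum.inl)) +
    y • (R.aug ∘ₗ LinearMap.funLeft _ _ (Sum.inl ∘ Sum.inr))

variable {R} in
lemma coneD_eq_iff {x y : MvPolynomial σ k} {i : ℕ} {v : R.coneι (i + 1) → MvPolynomial σ k}
    {w : R.coneι i → MvPolynomial σ k} :
    R.coneD x y i v = w ↔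
      R.d i (v ∘ Sum.inl ∘ Sum.inl) + y • (v ∘ R.inrι i) = w ∘ Sum.inl ∘ Sum.inl ∧
      R.d i (v ∘ Sum.inl ∘ Sum.inr) - x • (v ∘ R.inrι i) = w ∘ Sum.inl ∘ Sum.inr ∧
      -R.prevD i (v ∘ R.inrι i) = w ∘ Sum.inr := by
  constructor
  · rintro rfl
    exact ⟨rfl, rfl, rfl⟩
  · rintro ⟨h₁, h₂, h₃⟩
    funext c
    rcases c with (c | c) | c
    · exact congr_fun h₁ c
    · exact congr_fun h₂ c
    · exact congr_fun h₃ c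

lemma d_d (i : ℕ) (v) : R.d i (R.d (i + 1) v) = 0 := (R.exact i _).2 ⟨v, rfl⟩

lemma aug_d (v) : R.aug (R.d 0 v) = 0 := (R.aug_exact _).2 ⟨v, rfl⟩

lemma prevD_d (i : ℕ) (v) : R.prevD i (R.d i v) = 0 := by
  cases i with
  | zero => rfl
  | succ i => exact R.d_d i v

/-- For a cycle the shifted coordinate is a boundary `d c`; adding `y • c` and subtracting `x • c`
turns the other two coordinates into cycles of the original resolution, hence boundaries. -/
lemma coneD_exact {x y : MvPolynomial σ k} (hy : y ≠ 0) (i : ℕ)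
    (v : R.coneι (i + 1) → MvPolynomial σ k) :
    R.coneD x y i v = 0 ↔ ∃ w, R.coneD x y (i + 1) w = v := by
  constructor
  · intro h
    obtain ⟨h₁, h₂, h₃⟩ := coneD_eq_iff.1 h
    change _ = (0 : R.ι i → MvPolynomial σ k) at h₁ h₂
    change _ = (0 : R.prevι i → MvPolynomial σ k) at h₃
    rw [neg_eq_zero] at h₃
    have hc : ∃ c, R.d i c = (v ∘ R.inrι i) := by
      cases i with
      -- Here the shifted differential is zero and gives no information; applying `aug` to the first
      -- equation leaves `y * aug _ = 0`, and `y` cancels.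
      | zero =>
        rw [← R.aug_exact]
        have := congr_arg R.aug h₁
        rw [map_add, R.aug_d, zero_add, map_smul, map_zero, smul_eq_mul] at this
        exact (mul_eq_zero.1 this).resolve_left hy
      | succ i => exact (R.exact i _).1 h₃
    obtain ⟨c, hc⟩ := hc
    obtain ⟨a, ha⟩ := (R.exact i ((v ∘ Sum.inl ∘ Sum.inl) + y • c)).1 (by
      rw [map_add, map_smul, hc, h₁])
    obtain ⟨b, hb⟩ := (R.exact i ((v ∘ Sum.inl ∘ Sum.inr) - x • c)).1 (by
      rw [map_sub, map_smul, hc, h₂])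
    refine ⟨Sum.elim (Sum.elim a b) (-c), coneD_eq_iff.2 ⟨?_, ?_, ?_⟩⟩
    · change R.d (i + 1) a + y • (-c) = _
      rw [ha, smul_neg, add_neg_cancel_right]
    · change R.d (i + 1) b - x • (-c) = _
      rw [hb, smul_neg, sub_neg_eq_add, sub_add_cancel]
    · change -R.d i (-c) = _
      rw [map_neg, neg_neg, hc]
      rfl
  · rintro ⟨w, rfl⟩
    refine coneD_eq_iff.2 ⟨?_, ?_, ?_⟩
    · change R.d i (R.d (i + 1) (w ∘ Sum.inl ∘ Sum.inl) + y • (w ∘ R.inrι (i + 1)))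
        + y • (-R.d i (w ∘ R.inrι (i + 1))) = 0
      rw [map_add, d_d, map_smul, smul_neg, zero_add, add_neg_cancel]
    · change R.d i (R.d (i + 1) (w ∘ Sum.inl ∘ Sum.inr) - x • (w ∘ R.inrι (i + 1)))
        - x • (-R.d i (w ∘ R.inrι (i + 1))) = 0
      rw [map_sub, d_d, map_smul, smul_neg, zero_sub, sub_neg_eq_add, neg_add_cancel]
    · change -R.prevD i (-R.d i (w ∘ R.inrι (i + 1))) = 0
      rw [map_neg, prevD_d, neg_zero, neg_zero]

/-- If `x, y` are linear forms such that `y` is a nonzerodivisor modulo `J` and `x, y` is a regular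
sequence, then the mapping cone of `(y, -x) : F → F × F` resolves `(x, y) J`. -/
noncomputable def cone {x y : MvPolynomial σ k} (hx : x.IsHomogeneous 1) (hy : y.IsHomogeneous 1) (hy₀ : y ≠ 0)
    (hxy : ∀ a b, x * a + y * b = 0 → ∃ g, a = y * g ∧ b = -(x * g))
    (hJ : ∀ g, y * g ∈ J → g ∈ J) {J' : Ideal (MvPolynomial σ k)}
    (hJ' : ∀ f, f ∈ J' ↔ ∃ a ∈ J, ∃ b ∈ J, x * a + y * b = f) :
    LinearResolution J' (q + 1) where
  ι := R.coneι
  fintype i := by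
    have := R.fintype
    cases i with
    | zero => exact @instFintypeSum _ _ inferInstance (inferInstanceAs (Fintype PEmpty))
    | succ i => exact @instFintypeSum _ _ inferInstance (R.fintype i)
  d := R.coneD x y
  aug := R.coneAug x y
  d_hom i n v hv := by
    have h : ∀ (z : MvPolynomial σ k) (_ : z.IsHomogeneous 1) (c : R.ι i),
        (z * v (R.inrι i c)).IsHomogeneous (n + 1) := fun z hz c ↦ by
      have := hz.mul (hv (R.inrι i c))
      rwa [add_comm] at this
    rintro ((c | c) | c)
    · exact (R.d_hom i n (v ∘ Sum.inl ∘ Sum.inl) (fun _ ↦ hv _) c).add (h y hy c)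
    · exact (R.d_hom i n (v ∘ Sum.inl ∘ Sum.inr) (fun _ ↦ hv _) c).sub (h x hx c)
    · cases i with
      | zero => exact c.elim
      | succ i => exact (R.d_hom i n _ (fun _ ↦ hv _) c).neg
  aug_hom n v hv := by
    have h : ∀ (z : MvPolynomial σ k) (_ : z.IsHomogeneous 1) (w : R.ι 0 → MvPolynomial σ k)
        (_ : ∀ c, (w c).IsHomogeneous n), (z * R.aug w).IsHomogeneous (n + (q + 1)) :=
      fun z hz w hw ↦ by
        rw [← add_assoc, add_comm]
        exact hz.mul (R.aug_hom n w hw)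
    exact (h x hx _ fun _ ↦ hv _).add (h y hy _ fun _ ↦ hv _)
  d_mem i v := by
    have h : ∀ z : MvPolynomial σ k, z.IsHomogeneous 1 → z ∈ irrelevantIdeal σ k := by
      intro z hz
      rw [mem_irrelevantIdeal_iff]
      exact hz.coeff_eq_zero (by simp)
    rintro ((c | c) | c)
    · exact add_mem (R.d_mem i (v ∘ Sum.inl ∘ Sum.inl) c)
        (Ideal.mul_mem_right (v (R.inrι i c)) _ (h y hy))
    · exact sub_mem (R.d_mem i (v ∘ Sum.inl ∘ Sum.inr) c)
        (Ideal.mul_mem_right (v (R.inrι i c)) _ (h x hx))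
    · cases i with
      | zero => exact c.elim
      | succ i => exact neg_mem (R.d_mem i _ c)
  exact := R.coneD_exact hy₀
  aug_exact v := by
    constructor
    · intro h
      obtain ⟨g, h₁, h₂⟩ := hxy (R.aug (v ∘ Sum.inl ∘ Sum.inl)) (R.aug (v ∘ Sum.inl ∘ Sum.inr)) h
      -- The syzygy of $(x,y)$ has coefficient `g` with `y * g ∈ J`, so `g` itself lies in `J` and
      -- lifts to some `c`; correcting by multiples of `c` leaves cycles.
      obtain ⟨c, rfl⟩ := (R.mem_iff g).1 (hJ g ((R.mem_iff _).2 ⟨_, h₁⟩))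
      obtain ⟨a, ha⟩ := (R.aug_exact ((v ∘ Sum.inl ∘ Sum.inl) - y • c)).1 (by
        rw [map_sub, map_smul, h₁, smul_eq_mul, sub_self])
      obtain ⟨b, hb⟩ := (R.aug_exact ((v ∘ Sum.inl ∘ Sum.inr) + x • c)).1 (by
        rw [map_add, map_smul, h₂, smul_eq_mul, neg_add_cancel])
      refine ⟨Sum.elim (Sum.elim a b) c, coneD_eq_iff.2 ⟨?_, ?_, ?_⟩⟩
      · change R.d 0 a + y • c = _
        rw [ha, sub_add_cancel]
      · change R.d 0 b - x • c = _
        rw [hb, add_sub_cancel_right]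
      · funext c
        exact c.elim
    · rintro ⟨w, rfl⟩
      change x * R.aug (R.d 0 (w ∘ Sum.inl ∘ Sum.inl) + y • (w ∘ R.inrι 0))
        + y * R.aug (R.d 0 (w ∘ Sum.inl ∘ Sum.inr) - x • (w ∘ R.inrι 0)) = 0
      rw [map_add, map_sub, aug_d, aug_d, map_smul, map_smul, smul_eq_mul, smul_eq_mul]
      ring
  mem_iff f := by
    rw [hJ']
    constructor
    · rintro ⟨a, ha, b, hb, rfl⟩
      obtain ⟨a, rfl⟩ := (R.mem_iff a).1 ha
      obtain ⟨b, rfl⟩ := (R.mem_iff b).1 hb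
      exact ⟨Sum.elim (Sum.elim a b) 0, rfl⟩
    · rintro ⟨v, rfl⟩
      exact ⟨_, (R.mem_iff _).2 ⟨_, rfl⟩, _, (R.mem_iff _).2 ⟨_, rfl⟩, rfl⟩

/-- The ranks of the free resolution of `S ⧸ J`. -/
def quotRank : ℕ → ℕ
  | 0 => 1
  | i + 1 => @Fintype.card (R.ι i) (R.fintype i)

/-- An enumeration of the basis of a free module of a linear resolution. -/
noncomputable def enum (i : ℕ) : R.ι i ≃ Fin (R.quotRank (i + 1)) :=
  @Fintype.equivFin (R.ι i) (R.fintype i)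

/-- The degrees of the basis elements in the free resolution of `S ⧸ J`. -/
def quotDeg (q : ℕ) : ℕ → ℕ
  | 0 => 0
  | i + 1 => q + i

/-- The differentials of the free resolution of `S ⧸ J`. -/
noncomputable def quotD : ∀ i, (Fin (R.quotRank (i + 1)) → MvPolynomial σ k) →ₗ[MvPolynomial σ k]
    (Fin (R.quotRank i) → MvPolynomial σ k)
  | 0 => LinearMap.pi fun _ ↦ R.aug ∘ₗ LinearMap.funLeft _ _ (R.enum 0)
  | i + 1 => LinearMap.funLeft _ _ (R.enum i).symm ∘ₗ R.d i ∘ₗ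
      LinearMap.funLeft _ _ (R.enum (i + 1))

lemma mem_twistedPart_const {p a n : ℕ} {v : Fin p → MvPolynomial σ k} :
    v ∈ twistedPart σ k (fun _ ↦ a) n ↔
      ∀ c, v c = 0 ∨ ∃ m, m + a = n ∧ (v c).IsHomogeneous m := by
  rw [mem_twistedPart_iff]
  refine forall_congr' fun c ↦ ⟨fun h ↦ ?_, fun h m hm ↦ ?_⟩
  · rcases eq_or_ne (v c) 0 with h₀ | h₀
    · exact Or.inl h₀
    · obtain ⟨m, hm⟩ := ne_zero_iff.1 h₀
      refine Or.inr ⟨m.degree, h m hm, fun m' hm' ↦ ?_⟩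
      have h₁ := h m hm
      have h₂ := h m' hm'
      rw [Finsupp.degree_eq_weight_one] at h₁ h₂ ⊢
      exact Nat.add_right_cancel (h₂.trans h₁.symm)
  · rcases h with h | ⟨m', rfl, h⟩
    · simp [h] at hm
    · by_contra h'
      exact hm (h.coeff_eq_zero fun h'' ↦ h' (by rw [h'']))

/-- All basis vectors share the degree `a`, so one degree serves all coordinates; the zero
alternative covers `n < a`. -/
lemma exists_isHomogeneous_of_mem_twistedPart {p a n : ℕ} {v : Fin p → MvPolynomial σ k}
    (hv : v ∈ twistedPart σ k (fun _ ↦ a) n) :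
    v = 0 ∨ ∃ m, m + a = n ∧ ∀ c, (v c).IsHomogeneous m := by
  rw [mem_twistedPart_const] at hv
  by_cases h : a ≤ n
  · refine Or.inr ⟨n - a, Nat.sub_add_cancel h, fun c ↦ ?_⟩
    rcases hv c with h' | ⟨m, rfl, h'⟩
    · rw [h']
      exact isHomogeneous_zero _ _ _
    · rwa [Nat.add_sub_cancel]
  · refine Or.inl (funext fun c ↦ (hv c).resolve_right ?_)
    rintro ⟨m, rfl, -⟩
    omega

/-- The graded free resolution of `S ⧸ J` obtained from a linear resolution of `J`. -/
noncomputable def toGradedFreeResolution : GradedFreeResolution σ k (quotientGrading J) where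
  rank := R.quotRank
  deg i _ := quotDeg q i
  d := R.quotD
  aug := Submodule.mkQ J ∘ₗ LinearMap.proj (0 : Fin 1)
  d_graded i n v hv := by
    replace hv := exists_isHomogeneous_of_mem_twistedPart hv
    rcases hv with rfl | ⟨m, rfl, hv⟩
    · rw [map_zero, mem_twistedPart_const]
      exact fun _ ↦ Or.inl rfl
    · rw [mem_twistedPart_const]
      intro c
      cases i with
      | zero => exact Or.inr ⟨m + q, rfl, R.aug_hom m (v ∘ R.enum 0) fun _ ↦ hv _⟩
      | succ i =>
        refine Or.inr ⟨m + 1, ?_, R.d_hom i m (v ∘ R.enum (i + 1)) (fun _ ↦ hv _) _⟩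
        simp only [quotDeg]
        omega
  aug_graded n v hv := by
    refine ⟨v (0 : Fin 1), ?_, rfl⟩
    rcases mem_twistedPart_const.1 hv (0 : Fin 1) with h | ⟨m, rfl, h⟩
    · rw [h]
      exact zero_mem _
    · exact h
  exact i := by
    intro v
    cases i with
    | zero =>
      change (fun _ : Fin 1 ↦ R.aug (v ∘ R.enum 0)) = 0 ↔ _
      have : (fun _ : Fin 1 ↦ R.aug (v ∘ R.enum 0)) = 0 ↔ R.aug (v ∘ R.enum 0) = 0 :=
        ⟨fun h ↦ congr_fun h 0, fun h ↦ funext fun _ ↦ h⟩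
      rw [this, R.aug_exact]
      constructor
      · rintro ⟨w, hw⟩
        refine ⟨w ∘ (R.enum 1).symm, ?_⟩
        change R.d 0 ((w ∘ (R.enum 1).symm) ∘ R.enum 1) ∘ (R.enum 0).symm = v
        rw [Function.comp_assoc, Equiv.symm_comp_self, Function.comp_id, hw,
          Function.comp_assoc, Equiv.self_comp_symm, Function.comp_id]
      · rintro ⟨w, rfl⟩
        refine ⟨w ∘ R.enum 1, ?_⟩
        change _ = (R.d 0 (w ∘ R.enum 1) ∘ (R.enum 0).symm) ∘ R.enum 0
        rw [Function.comp_assoc, Equiv.symm_comp_self, Function.comp_id]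
    | succ i =>
      change R.d i (v ∘ R.enum (i + 1)) ∘ (R.enum i).symm = 0 ↔ _
      have : R.d i (v ∘ R.enum (i + 1)) ∘ (R.enum i).symm = 0 ↔
          R.d i (v ∘ R.enum (i + 1)) = 0 := by
        constructor
        · intro h
          funext c
          simpa using congr_fun h (R.enum i c)
        · intro h
          rw [h]
          rfl
      rw [this, R.exact]
      constructor
      · rintro ⟨w, hw⟩
        refine ⟨w ∘ (R.enum (i + 2)).symm, ?_⟩
        change R.d (i + 1) ((w ∘ (R.enum (i + 2)).symm) ∘ R.enum (i + 2)) ∘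
          (R.enum (i + 1)).symm = v
        rw [Function.comp_assoc, Equiv.symm_comp_self, Function.comp_id, hw,
          Function.comp_assoc, Equiv.self_comp_symm, Function.comp_id]
      · rintro ⟨w, rfl⟩
        refine ⟨w ∘ R.enum (i + 2), ?_⟩
        change _ = (R.d (i + 1) (w ∘ R.enum (i + 2)) ∘ (R.enum (i + 1)).symm) ∘ R.enum (i + 1)
        rw [Function.comp_assoc, Equiv.symm_comp_self, Function.comp_id]
  aug_exact := by
    intro v
    change Submodule.Quotient.mk (v (0 : Fin 1)) = 0 ↔ _
    rw [Submodule.Quotient.mk_eq_zero, R.mem_iff]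
    constructor
    · rintro ⟨w, hw⟩
      refine ⟨w ∘ (R.enum 0).symm, ?_⟩
      funext c
      change R.aug ((w ∘ (R.enum 0).symm) ∘ R.enum 0) = v c
      rw [Function.comp_assoc, Equiv.symm_comp_self, Function.comp_id, hw]
      congr 1
      exact (Subsingleton.elim (α := Fin 1) _ _)
    · rintro ⟨w, rfl⟩
      exact ⟨w ∘ R.enum 0, rfl⟩
  aug_surjective m := by
    obtain ⟨f, rfl⟩ := Submodule.mkQ_surjective J m
    exact ⟨fun _ ↦ f, rfl⟩

lemma isMinimal_toGradedFreeResolution (hJ : J ≤ irrelevantIdeal σ k) :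
    R.toGradedFreeResolution.IsMinimal := by
  intro i v c
  cases i with
  | zero => exact hJ ((R.mem_iff _).2 ⟨_, rfl⟩)
  | succ i => exact R.d_mem i _ _

end LinearResolution

/-- Taking homogeneous components descends to the quotient because `J` is stable under it; `key`
shows independence of the chosen representatives `s`. -/
lemma hasProjections_quotientGrading {J : Ideal (MvPolynomial σ k)}
    (hJ : ∀ f ∈ J, ∀ n, homogeneousComponent n f ∈ J) :
    HasProjections fun n ↦ (quotientGrading J n : Set (MvPolynomial σ k ⧸ J)) := by
  intro n
  let s : MvPolynomial σ k ⧸ J → MvPolynomial σ k :=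
    Function.surjInv Ideal.Quotient.mk_surjective
  have hs : ∀ m, Ideal.Quotient.mk J (s m) = m :=
    Function.surjInv_eq Ideal.Quotient.mk_surjective
  have key : ∀ f, Ideal.Quotient.mk J (homogeneousComponent n (s (Ideal.Quotient.mk J f))) =
      Ideal.Quotient.mk J (homogeneousComponent n f) := by
    intro f
    rw [Ideal.Quotient.eq, ← map_sub]
    exact hJ _ (Ideal.Quotient.eq.1 (hs _)) n
  refine ⟨AddMonoidHom.mk' (fun m ↦ Ideal.Quotient.mk J (homogeneousComponent n (s m))) ?_,
    ?_, ?_⟩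
  · intro a b
    have : a + b = Ideal.Quotient.mk J (s a + s b) := by rw [map_add, hs, hs]
    rw [this, key, map_add, map_add]
  · rintro _ ⟨f, hf, rfl⟩
    exact (key f).trans (congr_arg _ (by rw [homogeneousComponent_of_mem hf, if_pos rfl]))
  · rintro j hj _ ⟨f, hf, rfl⟩
    refine (key f).trans ?_
    rw [homogeneousComponent_of_mem hf, if_neg hj.symm, map_zero]

/-- The regularity of the quotient by an ideal with a linear resolution. -/
lemma LinearResolution.hasRegularity {J : Ideal (MvPolynomial σ k)} {q : ℕ}
    (R : LinearResolution J q) (hq : 0 < q) (hJ : J ≤ irrelevantIdeal σ k) (hJ₀ : J ≠ ⊥)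
    (hJ' : ∀ f ∈ J, ∀ n, homogeneousComponent n f ∈ J) :
    HasRegularity σ (quotientGrading J) ((q : ℤ) - 1) := by
  refine (R.isMinimal_toGradedFreeResolution hJ).hasRegularity
    -- The generators of `J` sit in homological degree 1 and degree `q`. Later terms also give `q +
    -- i - (i + 1) = q - 1`, while the term of `S` itself gives 0, which is where `0 < q` enters.
    (hasProjections_quotientGrading hJ') ⟨⟨1, q, ?_, by simp⟩, ?_⟩
  · rw [GradedFreeResolution.betti_ne_zero_iff]
    have : Nonempty (R.ι 0) := by
      by_contra h
      rw [not_nonempty_iff] at h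
      refine hJ₀ (eq_bot_iff.2 fun f hf ↦ ?_)
      obtain ⟨v, rfl⟩ := (R.mem_iff f).1 hf
      rw [Subsingleton.elim v 0, map_zero]
      exact zero_mem _
    exact ⟨R.enum 0 this.some, rfl⟩
  · rintro z ⟨i, j, h, rfl⟩
    obtain ⟨c, rfl⟩ := (GradedFreeResolution.betti_ne_zero_iff _ _ _).1 h
    change ((quotDeg q i : ℕ) : ℤ) - i ≤ _
    cases i with
    | zero =>
      simp only [quotDeg]
      omega
    | succ i =>
      simp only [quotDeg]
      push_cast
      omega

end LinearResolution

end MonomialCut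

namespace MonomialCut

/-! ### Vanishing of Ext along short exact sequences. -/

section Ext

universe u

open CategoryTheory Abelian

variable {R : Type u} [CommRing R]

/-- The vanishing of `Ext^j(K, M)`. -/
def ExtVanishes (R : Type u) [CommRing R] (K M : Type u) [AddCommGroup K] [Module R K]
    [AddCommGroup M] [Module R M] (j : ℕ) : Prop :=
  Subsingleton (Ext (ModuleCat.of R K) (ModuleCat.of R M) j)

variable {K A B C : Type u} [AddCommGroup K] [Module R K] [AddCommGroup A] [Module R A]
  [AddCommGroup B] [Module R B] [AddCommGroup C] [Module R C]

lemma extVanishes_iff {j : ℕ} : ExtVanishes R K A j ↔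
    ∀ x : Ext (ModuleCat.of R K) (ModuleCat.of R A) j, x = 0 :=
  ⟨fun h _ ↦ @Subsingleton.elim _ h _ _, fun h ↦ ⟨fun x y ↦ (h x).trans (h y).symm⟩⟩

lemma extVanishes_zero_iff : ExtVanishes R K A 0 ↔ Subsingleton (K →ₗ[R] A) :=
  (Ext.addEquiv₀.trans ModuleCat.homAddEquiv).toEquiv.subsingleton_congr

lemma shortExact_of_exact {f : A →ₗ[R] B} {g : B →ₗ[R] C} (hf : Function.Injective f)
    (hg : Function.Surjective g) (h : Function.Exact f g) :
    (ModuleCat.shortComplexOfCompEqZero f g h.linearMap_comp_eq_zero).ShortExact where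
  exact := ModuleCat.shortComplex_exact _ h
  mono_f := (ModuleCat.mono_iff_injective _).2 hf
  epi_g := (ModuleCat.epi_iff_surjective _).2 hg

lemma ExtVanishes.of_retract {i : A →ₗ[R] B} {r : B →ₗ[R] A} (h : r ∘ₗ i = LinearMap.id)
    {j : ℕ} (hB : ExtVanishes R K B j) : ExtVanishes R K A j := by
  rw [extVanishes_iff] at hB ⊢
  intro x
  have : ModuleCat.ofHom i ≫ ModuleCat.ofHom r = 𝟙 _ := by
    rw [← ModuleCat.ofHom_comp, h, ModuleCat.ofHom_id]
  rw [← x.comp_mk₀_id, ← this, ← Ext.mk₀_comp_mk₀,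
    ← Ext.comp_assoc x (Ext.mk₀ (ModuleCat.ofHom i)) (Ext.mk₀ (ModuleCat.ofHom r))
      (add_zero j) (add_zero 0) (by simp),
    hB (x.comp (Ext.mk₀ (ModuleCat.ofHom i)) (add_zero j)), Ext.zero_comp]

lemma extVanishes_congr (e : A ≃ₗ[R] B) {j : ℕ} :
    ExtVanishes R K A j ↔ ExtVanishes R K B j :=
  ⟨fun h ↦ h.of_retract (i := e.symm.toLinearMap) (r := e.toLinearMap) (by ext; simp),
    fun h ↦ h.of_retract (i := e.toLinearMap) (r := e.symm.toLinearMap) (by ext; simp)⟩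

section Exact

variable {f : A →ₗ[R] B} {g : B →ₗ[R] C} (hf : Function.Injective f)
    (hg : Function.Surjective g) (h : Function.Exact f g)

include hf hg h

lemma ExtVanishes.of_middle_of_left {j : ℕ} (hB : ExtVanishes R K B j)
    (hA : ExtVanishes R K A (j + 1)) : ExtVanishes R K C j := by
  rw [extVanishes_iff] at hA hB ⊢
  intro x
  obtain ⟨y, rfl⟩ := Ext.covariant_sequence_exact₃ _ (shortExact_of_exact hf hg h) x rfl (hA _)
  rw [hB y, Ext.zero_comp]

lemma ExtVanishes.of_right_of_middle {j : ℕ} (hC : ExtVanishes R K C j)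
    (hB : ExtVanishes R K B (j + 1)) : ExtVanishes R K A (j + 1) := by
  rw [extVanishes_iff] at hC hB ⊢
  intro x
  obtain ⟨y, rfl⟩ := Ext.covariant_sequence_exact₁ _ (shortExact_of_exact hf hg h) x (hB _) rfl
  rw [hC y, Ext.zero_comp]

lemma ExtVanishes.of_left_of_right {j : ℕ} (hA : ExtVanishes R K A j)
    (hC : ExtVanishes R K C j) : ExtVanishes R K B j := by
  rw [extVanishes_iff] at hA hC ⊢
  intro x
  obtain ⟨y, rfl⟩ := Ext.covariant_sequence_exact₂ _ (shortExact_of_exact hf hg h) x (hC _)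
  rw [hA y, Ext.zero_comp]

/-- When `f` induces zero on Ext, the long exact sequence splits into $0\to \mathrm{Ext}^j(K,B)\to
\mathrm{Ext}^j(K,C)\to \mathrm{Ext}^{j+1}(K,A)\to 0$. -/
lemma extVanishes_right_iff
    (h₀ : ∀ j (x : Ext (ModuleCat.of R K) (ModuleCat.of R A) j),
      x.comp (Ext.mk₀ (ModuleCat.ofHom f)) (add_zero j) = 0) (j : ℕ) :
    ExtVanishes R K C j ↔ ExtVanishes R K B j ∧ ExtVanishes R K A (j + 1) := by
  refine ⟨fun hC ↦ ?_, fun hBA ↦ ExtVanishes.of_middle_of_left hf hg h hBA.1 hBA.2⟩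
  simp only [extVanishes_iff] at hC ⊢
  constructor
  · intro x
    obtain ⟨y, rfl⟩ := Ext.covariant_sequence_exact₂ _ (shortExact_of_exact hf hg h) x (hC _)
    exact h₀ j y
  · intro x
    obtain ⟨y, rfl⟩ := Ext.covariant_sequence_exact₁ _ (shortExact_of_exact hf hg h) x
      (h₀ _ x) rfl
    rw [hC y, Ext.zero_comp]

end Exact

lemma extVanishes_prod_iff {j : ℕ} : ExtVanishes R K (A × A) j ↔ ExtVanishes R K A j := by
  constructor
  · exact fun h ↦ h.of_retract (i := LinearMap.inl R A A) (r := LinearMap.fst R A A)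
      (by ext; simp)
  · exact fun h ↦ ExtVanishes.of_left_of_right (f := LinearMap.inl R A A)
      (g := LinearMap.snd R A A) LinearMap.inl_injective LinearMap.snd_surjective
      .inl_snd h h

/-- The action of `r` on Ext can be computed on the first argument `K`, where it is zero. -/
lemma comp_mk₀_smul_eq_zero {r : R} (hr : r ∈ Module.annihilator R K) (f : A →ₗ[R] B) (j : ℕ)
    (x : Ext (ModuleCat.of R K) (ModuleCat.of R A) j) :
    x.comp (Ext.mk₀ (ModuleCat.ofHom (r • f))) (add_zero j) = 0 := by
  have h₁ : r • 𝟙 (ModuleCat.of R K) = 0 := by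
    ext m
    exact Module.mem_annihilator.1 hr m
  have h₂ : r • x = 0 := by
    have : r • x = (Ext.mk₀ (r • 𝟙 (ModuleCat.of R K))).comp x (zero_add j) := by
      simp [Ext.mk₀_smul]
    rw [this, h₁, Ext.mk₀_zero, Ext.zero_comp]
  have h₃ : ModuleCat.ofHom (r • f) = r • ModuleCat.ofHom f := rfl
  rw [h₃, Ext.mk₀_smul, Ext.comp_smul, ← Ext.smul_comp, h₂, Ext.zero_comp]

/-- Multiplication by a nonzerodivisor that annihilates `K`. -/
lemma extVanishes_quotient_iff {r : R} (hr : r ∈ Module.annihilator R K) {g : A →ₗ[R] C}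
    (hr' : Function.Injective (r • (LinearMap.id : A →ₗ[R] A))) (hg : Function.Surjective g)
    (h : Function.Exact (r • (LinearMap.id : A →ₗ[R] A)) g) (j : ℕ) :
    ExtVanishes R K C j ↔ ExtVanishes R K A j ∧ ExtVanishes R K A (j + 1) :=
  extVanishes_right_iff hr' hg h (fun j x ↦ comp_mk₀_smul_eq_zero hr _ j x) j

/-- If `y` is a nonzerodivisor modulo `J` and `x, y` is a regular sequence, then
`0 → J → J × J → (x, y) J → 0` is exact. -/
lemma extVanishes_mul_iff [IsDomain R] {x y : R} (hx : x ∈ Module.annihilator R K)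
    (hy : y ∈ Module.annihilator R K) (hy₀ : y ≠ 0) {J J' : Ideal R}
    (hxy : ∀ a b, x * a + y * b = 0 → ∃ g, a = y * g ∧ b = -(x * g))
    (hJ : ∀ g, y * g ∈ J → g ∈ J)
    (hJ' : ∀ f, f ∈ J' ↔ ∃ a ∈ J, ∃ b ∈ J, x * a + y * b = f) (j : ℕ) :
    ExtVanishes R K J' j ↔ ExtVanishes R K J j ∧ ExtVanishes R K J (j + 1) := by
  let f : J →ₗ[R] J × J := y • LinearMap.inl R J J + (-x) • LinearMap.inr R J J
  let g : J × J →ₗ[R] J' := LinearMap.codRestrict J'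
    (x • (J.subtype ∘ₗ LinearMap.fst R J J) + y • (J.subtype ∘ₗ LinearMap.snd R J J))
    (fun c ↦ (hJ' _).2 ⟨c.1, c.1.2, c.2, c.2.2, rfl⟩)
  have hf₁ : ∀ a, ((f a).1 : R) = y * a := fun a ↦ by simp [f]
  have hf₂ : ∀ a, ((f a).2 : R) = -(x * a) := fun a ↦ by simp [f]
  have hg₁ : ∀ a, (g a : R) = x * a.1 + y * a.2 := fun a ↦ rfl
  have hf : Function.Injective f := by
    intro a b hab
    have : y * (a : R) = y * b := by rw [← hf₁, ← hf₁, hab]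
    exact Subtype.ext (mul_left_cancel₀ hy₀ this)
  have hg : Function.Surjective g := by
    rintro ⟨c, hc⟩
    obtain ⟨a, ha, b, hb, rfl⟩ := (hJ' c).1 hc
    exact ⟨(⟨a, ha⟩, ⟨b, hb⟩), rfl⟩
  have hfg : Function.Exact f g := by
    rintro ⟨a, b⟩
    constructor
    · intro h
      obtain ⟨c, h₁, h₂⟩ := hxy a b (by rw [← hg₁ (a, b), h]; rfl)
      refine ⟨⟨c, hJ c (h₁ ▸ a.2)⟩, Prod.ext (Subtype.ext ?_) (Subtype.ext ?_)⟩
      · exact (hf₁ _).trans h₁.symm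
      · exact (hf₂ _).trans h₂.symm
    · rintro ⟨c, hc⟩
      refine Subtype.ext ?_
      rw [← hc, hg₁, hf₁, hf₂]
      simp only [ZeroMemClass.coe_zero]
      ring
  rw [extVanishes_right_iff (K := K) hf hg hfg, extVanishes_prod_iff]
  intro j z
  -- Both components of `f` are multiples of elements killing `K`, so `f` induces zero on Ext.
  have : ModuleCat.ofHom f = ModuleCat.ofHom (y • LinearMap.inl R J J) +
      ModuleCat.ofHom ((-x) • LinearMap.inr R J J) := rfl
  rw [this, Ext.mk₀_add, Ext.comp_add, comp_mk₀_smul_eq_zero hy,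
    comp_mk₀_smul_eq_zero (neg_mem hx), add_zero]

end Ext

end MonomialCut

namespace MonomialCut

open MvPolynomial

/-! ### The product of the ideals $(s_e,t_e)$. -/

section EdgeIdeal

variable {E k : Type*} [Field k]

/-- The product of the ideals `(s_e, t_e)` over the edges `e` in `T`. -/
noncomputable def edgeIdeal (k : Type*) [Field k] (T : Finset E) :
    Ideal (MvPolynomial (E ⊕ E) k) :=
  ∏ e ∈ T, Ideal.span {X (Sum.inl e), X (Sum.inr e)}

lemma edgeIdeal_empty : edgeIdeal k (∅ : Finset E) = ⊤ := by
  simp [edgeIdeal]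

lemma mem_edgeIdeal_insert [DecidableEq E] {T : Finset E} {e : E} (he : e ∉ T)
    (f : MvPolynomial (E ⊕ E) k) : f ∈ edgeIdeal k (insert e T) ↔
      ∃ a ∈ edgeIdeal k T, ∃ b ∈ edgeIdeal k T, X (Sum.inl e) * a + X (Sum.inr e) * b = f := by
  rw [edgeIdeal, Finset.prod_insert he, Ideal.span_insert, Ideal.sup_mul, Submodule.mem_sup]
  simp only [Ideal.mem_span_singleton_mul]
  constructor
  · rintro ⟨_, ⟨a, ha, rfl⟩, _, ⟨b, hb, rfl⟩, rfl⟩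
    exact ⟨a, ha, b, hb, rfl⟩
  · rintro ⟨a, ha, b, hb, rfl⟩
    exact ⟨_, ⟨a, ha, rfl⟩, _, ⟨b, hb, rfl⟩, rfl⟩

/-- The factors involve disjoint sets of variables, so their product is their intersection, and the
latter is tested monomial by monomial. -/
lemma mem_edgeIdeal_iff {T : Finset E} {f : MvPolynomial (E ⊕ E) k} :
    f ∈ edgeIdeal k T ↔ ∀ m ∈ f.support, ∀ e ∈ T, m (Sum.inl e) ≠ 0 ∨ m (Sum.inr e) ≠ 0 := by
  classical
  constructor
  · intro hf m hm e he
    have h : edgeIdeal k T ≤ Ideal.span (X '' {Sum.inl e, Sum.inr e}) := by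
      rw [Set.image_pair]
      exact Ideal.prod_le_inf.trans (Finset.inf_le he)
    obtain ⟨i, hi, h⟩ := mem_ideal_span_X_image.1 (h hf) m hm
    rcases hi with rfl | rfl
    · exact Or.inl h
    · exact Or.inr h
  · intro h
    rw [f.as_sum]
    refine Ideal.sum_mem _ fun m hm ↦ ?_
    replace h := h m hm
    generalize coeff m f = c
    clear hm
    induction T using Finset.induction_on generalizing m with
    | empty => rw [edgeIdeal_empty]; trivial
    | insert e T he ih =>
      -- Dividing a monomial by a variable of `e` does not affect its exponents at the edges of `T`,
      -- so the quotient still satisfies the criterion for `T`.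
      have key : ∀ i, m i ≠ 0 → (i = Sum.inl e ∨ i = Sum.inr e) →
          ∃ a ∈ edgeIdeal k T, X i * a = monomial m c := by
        intro i hi hie
        refine ⟨monomial (m - Finsupp.single i 1) c, ih _ fun e' he' ↦ ?_, ?_⟩
        · have hne : e' ≠ e := fun h' ↦ he (h' ▸ he')
          have := h e' (Finset.mem_insert_of_mem he')
          rcases hie with rfl | rfl <;> simpa [hne, hne.symm] using this
        · rw [X, monomial_mul, one_mul, add_tsub_cancel_of_le]
          rwa [Finsupp.single_le_iff, Nat.one_le_iff_ne_zero]
      rw [mem_edgeIdeal_insert he]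
      rcases h e (Finset.mem_insert_self e T) with h | h
      · obtain ⟨a, ha, h⟩ := key _ h (Or.inl rfl)
        exact ⟨a, ha, 0, zero_mem _, by rw [mul_zero, add_zero, h]⟩
      · obtain ⟨a, ha, h⟩ := key _ h (Or.inr rfl)
        exact ⟨0, zero_mem _, a, ha, by rw [mul_zero, zero_add, h]⟩

lemma mem_edgeIdeal_of_X_mul_mem {T : Finset E} {e : E} (he : e ∉ T)
    (g : MvPolynomial (E ⊕ E) k) (hg : X (Sum.inr e) * g ∈ edgeIdeal k T) :
    g ∈ edgeIdeal k T := by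
  classical
  rw [mem_edgeIdeal_iff] at hg ⊢
  intro m hm e' he'
  have hne : e ≠ e' := fun h ↦ he (h ▸ he')
  have := hg (Finsupp.single (Sum.inr e) 1 + m)
    (by rw [mem_support_iff, coeff_X_mul]; exact mem_support_iff.1 hm) e' he'
  simpa [hne, hne.symm] using this

lemma homogeneousComponent_mem_edgeIdeal {T : Finset E} (f : MvPolynomial (E ⊕ E) k)
    (hf : f ∈ edgeIdeal k T) (n : ℕ) : homogeneousComponent n f ∈ edgeIdeal k T := by
  rw [mem_edgeIdeal_iff] at hf ⊢
  intro m hm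
  refine hf m ?_
  rw [mem_support_iff, coeff_homogeneousComponent] at hm
  rw [mem_support_iff]
  exact fun h ↦ hm (by rw [h, ite_self])

lemma edgeIdeal_le_irrelevantIdeal {T : Finset E} (hT : T.Nonempty) :
    edgeIdeal k T ≤ irrelevantIdeal (E ⊕ E) k := by
  obtain ⟨e, he⟩ := hT
  intro f hf
  rw [mem_irrelevantIdeal_iff]
  by_contra h
  simpa using mem_edgeIdeal_iff.1 hf 0 (mem_support_iff.2 h) e he

lemma edgeIdeal_ne_bot (T : Finset E) : edgeIdeal k T ≠ ⊥ := by
  rw [edgeIdeal, ← Ideal.zero_eq_bot, Finset.prod_ne_zero_iff]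
  intro e _ h
  have : X (Sum.inl e) ∈ (0 : Ideal (MvPolynomial (E ⊕ E) k)) :=
    h ▸ Ideal.subset_span (Set.mem_insert _ _)
  exact X_ne_zero _ this

lemma mem_span_X_of_X_mul_mem {σ : Type*} {T : Set σ} {i : σ} (hi : i ∉ T) {f : MvPolynomial σ k}
    (hf : X i * f ∈ Ideal.span (X '' T)) : f ∈ Ideal.span (X '' T) := by
  classical
  rw [mem_ideal_span_X_image] at hf ⊢
  intro m hm
  obtain ⟨j, hj, h⟩ := hf (Finsupp.single i 1 + m)
    (by rw [mem_support_iff, coeff_X_mul]; exact mem_support_iff.1 hm)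
  have : i ≠ j := fun h ↦ hi (h ▸ hj)
  exact ⟨j, hj, by simpa [this] using h⟩

/-- Two distinct variables form a regular sequence, so their only syzygies are the Koszul ones. -/
lemma exists_of_X_mul_add_X_mul_eq_zero {σ : Type*} {i j : σ} (hij : i ≠ j)
    (a b : MvPolynomial σ k) (h : X i * a + X j * b = 0) :
    ∃ g, a = X j * g ∧ b = -(X i * g) := by
  have h₁ : a ∈ Ideal.span (X '' {j} : Set (MvPolynomial σ k)) := by
    refine mem_span_X_of_X_mul_mem (i := i) (by simpa using hij) ?_
    rw [Set.image_singleton, Ideal.mem_span_singleton]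
    exact ⟨-b, by rw [mul_neg]; exact eq_neg_of_add_eq_zero_left h⟩
  rw [Set.image_singleton, Ideal.mem_span_singleton] at h₁
  obtain ⟨g, rfl⟩ := h₁
  refine ⟨g, rfl, mul_left_cancel₀ (X_ne_zero j) ?_⟩
  linear_combination h

/-- The product of the ideals `(s_e, t_e)` has a linear resolution. -/
lemma nonempty_linearResolution_edgeIdeal (T : Finset E) :
    Nonempty (LinearResolution (edgeIdeal k T) T.card) := by
  classical
  induction T using Finset.induction_on with
  | empty =>
    rw [edgeIdeal_empty]
    exact ⟨LinearResolution.unit _ _⟩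
  | insert e T he ih =>
    obtain ⟨R⟩ := ih
    rw [Finset.card_insert_of_notMem he]
    exact ⟨R.cone (isHomogeneous_X _ _) (isHomogeneous_X _ _) (X_ne_zero _)
      (exists_of_X_mul_add_X_mul_eq_zero Sum.inl_ne_inr) (mem_edgeIdeal_of_X_mul_mem he)
      (mem_edgeIdeal_insert he)⟩

end EdgeIdeal

/-! ### Ext of the residue field into the polynomial ring. -/

section ResidueField

variable {σ k : Type*} [Field k]

lemma X_mem_annihilator (i : σ) : (X i : MvPolynomial σ k) ∈
    Module.annihilator (MvPolynomial σ k) (MvPolynomial σ k ⧸ irrelevantIdeal σ k) := by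
  rw [Ideal.annihilator_quotient]
  exact Ideal.subset_span ⟨i, rfl⟩

/-- The vanishing of `Ext^j(k, S ⧸ (x_i : i ∈ T))`. -/
def ExtVanishesQuot (k : Type*) [Field k] (T : Finset σ) (j : ℕ) : Prop :=
  ExtVanishes (MvPolynomial σ k) (MvPolynomial σ k ⧸ irrelevantIdeal σ k)
    (MvPolynomial σ k ⧸ Ideal.span (X '' (T : Set σ) : Set (MvPolynomial σ k))) j

lemma isSMulRegular_X {T : Set σ} {i : σ} (hi : i ∉ T) :
    IsSMulRegular (MvPolynomial σ k ⧸ Ideal.span (X '' T : Set (MvPolynomial σ k)))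
      (X i : MvPolynomial σ k) := by
  rw [isSMulRegular_iff_right_eq_zero_of_smul]
  intro x hx
  obtain ⟨f, rfl⟩ := Ideal.Quotient.mk_surjective x
  rw [Ideal.Quotient.eq_zero_iff_mem]
  refine mem_span_X_of_X_mul_mem hi ?_
  rw [← Ideal.Quotient.eq_zero_iff_mem, map_mul]
  exact hx

/-- Multiplication by $x_i$ is injective on $S/(T)$, has cokernel $S/(T,x_i)$, and kills the residue
field. -/
lemma extVanishesQuot_insert_iff [DecidableEq σ] {T : Finset σ} {i : σ} (hi : i ∉ T) (j : ℕ) :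
    ExtVanishesQuot k (insert i T) j ↔ ExtVanishesQuot k T j ∧ ExtVanishesQuot k T (j + 1) := by
  have hle : Ideal.span (X '' (T : Set σ) : Set (MvPolynomial σ k)) ≤
      Ideal.span (X '' ((insert i T : Finset σ) : Set σ)) :=
    Ideal.span_mono (Set.image_mono (by simp))
  refine extVanishes_quotient_iff (X_mem_annihilator i) (g := Submodule.factor hle)
    ?_ (Submodule.factor_surjective hle) ?_ j
  · exact isSMulRegular_X (by simpa using hi)
  · intro x
    obtain ⟨f, rfl⟩ := Ideal.Quotient.mk_surjective x
    constructor
    · intro h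
      have h' : f ∈ Ideal.span (X '' ((insert i T : Finset σ) : Set σ)) :=
        (Submodule.Quotient.mk_eq_zero _).1 h
      rw [Finset.coe_insert, Set.image_insert_eq, Ideal.mem_span_insert] at h'
      obtain ⟨a, b, hb, rfl⟩ := h'
      refine ⟨Ideal.Quotient.mk _ a, ?_⟩
      change Ideal.Quotient.mk _ (X i * a) = _
      rw [Ideal.Quotient.eq, mul_comm a, sub_add_cancel_left]
      exact neg_mem hb
    · rintro ⟨y, hy⟩
      obtain ⟨a, rfl⟩ := Ideal.Quotient.mk_surjective y
      rw [← hy]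
      refine (Submodule.Quotient.mk_eq_zero _).2 (Ideal.mul_mem_right _ _ (Ideal.subset_span ?_))
      exact ⟨i, by simp, rfl⟩

variable [Fintype σ]

/-- Adjoining a variable outside `T` lowers `j` by one. At `j = 0` such a variable is a
nonzerodivisor on the target and kills the source, so there are no nonzero maps. -/
lemma extVanishesQuot_of_lt (j : ℕ) : ∀ T : Finset σ, j + T.card < Fintype.card σ →
    ExtVanishesQuot k T j := by
  classical
  induction j with
  | zero =>
    intro T hT
    rw [zero_add] at hT
    obtain ⟨i, -, hi⟩ := Finset.exists_mem_notMem_of_card_lt_card (t := Finset.univ) hT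
    rw [ExtVanishesQuot, extVanishes_zero_iff]
    exact (isSMulRegular_X (by simpa using hi)).linearMap_subsingleton_of_mem_annihilator
      (X_mem_annihilator i)
  | succ j ih =>
    intro T hT
    obtain ⟨i, -, hi⟩ := Finset.exists_mem_notMem_of_card_lt_card (t := Finset.univ)
      (show T.card < Fintype.card σ by omega)
    refine ((extVanishesQuot_insert_iff hi j).1 (ih _ ?_)).2
    rw [Finset.card_insert_of_notMem hi]
    omega

lemma not_extVanishesQuot_univ : ¬ ExtVanishesQuot k (Finset.univ : Finset σ) 0 := by
  rw [ExtVanishesQuot, extVanishes_zero_iff, Finset.coe_univ, Set.image_univ]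
  intro h
  have h₁ := LinearMap.congr_fun (h.elim LinearMap.id 0) (Ideal.Quotient.mk _ 1)
  exact one_notMem_irrelevantIdeal (Ideal.Quotient.eq_zero_iff_mem.1 h₁)

/-- Each variable adjoined shortens the range of vanishing by one. With all variables adjoined, `j =
0` remains, which contradicts `not_extVanishesQuot_univ`; hence some Ext of $S$ in degree at most
$|\sigma|$ is nonzero. -/
lemma extVanishesQuot_of_forall (h : ∀ j ≤ Fintype.card σ, ExtVanishesQuot k (∅ : Finset σ) j)
    (T : Finset σ) : ∀ j, j + T.card ≤ Fintype.card σ → ExtVanishesQuot k T j := by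
  classical
  induction T using Finset.induction_on with
  | empty => simpa using h
  | insert i T hi ih =>
    intro j hj
    rw [Finset.card_insert_of_notMem hi] at hj
    exact (extVanishesQuot_insert_iff hi j).2 ⟨ih _ (by omega), ih _ (by omega)⟩

/-- Vanishing of `Ext^j(k, S)` for a polynomial ring `S`. -/
lemma extVanishes_self_iff {j : ℕ} (hj : j ≤ Fintype.card σ) :
    ExtVanishes (MvPolynomial σ k) (MvPolynomial σ k ⧸ irrelevantIdeal σ k)
      (MvPolynomial σ k) j ↔ j < Fintype.card σ := by
  have h : ExtVanishes (MvPolynomial σ k) (MvPolynomial σ k ⧸ irrelevantIdeal σ k)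
      (MvPolynomial σ k) j ↔ ExtVanishesQuot k (∅ : Finset σ) j :=
    (extVanishes_congr (Submodule.quotEquivOfEqBot _ (by simp))).symm
  rw [h]
  constructor
  · intro h
    by_contra h'
    refine not_extVanishesQuot_univ (σ := σ) (k := k)
      (extVanishesQuot_of_forall (fun i hi ↦ ?_) _ _ (by simp))
    rcases hi.lt_or_eq with hi | rfl
    · exact extVanishesQuot_of_lt i _ (by simpa)
    · rwa [show Fintype.card σ = j by omega]
  · exact fun h ↦ extVanishesQuot_of_lt j _ (by simpa)

end ResidueField

/-! ### Depth of the quotient by the product ideal. -/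

section Depth

variable {E k : Type*} [Field k]

/-- Each edge replaces the condition at `j` by those at `j` and `j + 1`, so the range of degrees
grows by one per edge. -/
lemma extVanishes_edgeIdeal_iff (T : Finset E) : ∀ j,
    ExtVanishes (MvPolynomial (E ⊕ E) k) (MvPolynomial (E ⊕ E) k ⧸ irrelevantIdeal (E ⊕ E) k)
      (edgeIdeal k T) j ↔ ∀ a ≤ T.card, ExtVanishes (MvPolynomial (E ⊕ E) k)
        (MvPolynomial (E ⊕ E) k ⧸ irrelevantIdeal (E ⊕ E) k) (MvPolynomial (E ⊕ E) k) (j + a) := by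
  classical
  induction T using Finset.induction_on with
  | empty =>
    intro j
    simp only [Finset.card_empty, nonpos_iff_eq_zero, forall_eq, add_zero]
    rw [edgeIdeal_empty]
    exact extVanishes_congr Submodule.topEquiv
  | insert e T he ih =>
    intro j
    rw [extVanishes_mul_iff (X_mem_annihilator _) (X_mem_annihilator _) (X_ne_zero _)
      (exists_of_X_mul_add_X_mul_eq_zero Sum.inl_ne_inr) (mem_edgeIdeal_of_X_mul_mem he)
      (mem_edgeIdeal_insert he), ih, ih, Finset.card_insert_of_notMem he]
    constructor
    · rintro ⟨h₁, h₂⟩ a ha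
      rcases ha.lt_or_eq with ha | rfl
      · exact h₁ a (by omega)
      · have := h₂ _ le_rfl
        rwa [add_right_comm] at this
    · refine fun h ↦ ⟨fun a ha ↦ h a (by omega), fun a ha ↦ ?_⟩
      have := h (a + 1) (by omega)
      rwa [← add_assoc, add_right_comm] at this

variable [Fintype E]

lemma extVanishes_quotient_edgeIdeal_of_lt {j : ℕ} (hj : j + 1 < Fintype.card E) :
    ExtVanishes (MvPolynomial (E ⊕ E) k) (MvPolynomial (E ⊕ E) k ⧸ irrelevantIdeal (E ⊕ E) k)
      (MvPolynomial (E ⊕ E) k ⧸ edgeIdeal k (Finset.univ : Finset E)) j := by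
  have hc : Fintype.card (E ⊕ E) = Fintype.card E + Fintype.card E := Fintype.card_sum
  refine ExtVanishes.of_middle_of_left (Submodule.subtype_injective _)
    (Submodule.mkQ_surjective _) (LinearMap.exact_subtype_mkQ _)
    ((extVanishes_self_iff (by omega)).2 (by omega))
    ((extVanishes_edgeIdeal_iff _ _).2 fun a ha ↦ ?_)
  rw [Finset.card_univ] at ha
  exact (extVanishes_self_iff (by omega)).2 (by omega)

lemma not_extVanishes_quotient_edgeIdeal {j : ℕ} (hj : j + 1 = Fintype.card E) :
    ¬ ExtVanishes (MvPolynomial (E ⊕ E) k) (MvPolynomial (E ⊕ E) k ⧸ irrelevantIdeal (E ⊕ E) k)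
      (MvPolynomial (E ⊕ E) k ⧸ edgeIdeal k (Finset.univ : Finset E)) j := by
  have hc : Fintype.card (E ⊕ E) = Fintype.card E + Fintype.card E := Fintype.card_sum
  intro h
  have h₁ := ExtVanishes.of_right_of_middle (Submodule.subtype_injective _)
    (Submodule.mkQ_surjective _) (LinearMap.exact_subtype_mkQ _) h
    ((extVanishes_self_iff (by omega)).2 (by omega))
  -- The top of the range is degree $(j+1)+|E|=2|E|$, the number of variables, where Ext of $S$ does
  -- not vanish.
  have h₂ := (extVanishes_edgeIdeal_iff _ _).1 h₁ _ le_rfl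
  rw [Finset.card_univ] at h₂
  have h₃ := (extVanishes_self_iff (by omega)).1 h₂
  omega

lemma irrelevantIdeal_smul_top_lt {σ : Type*} {J : Ideal (MvPolynomial σ k)}
    (hJ : J ≤ irrelevantIdeal σ k) :
    irrelevantIdeal σ k • (⊤ : Submodule (MvPolynomial σ k) (MvPolynomial σ k ⧸ J)) < ⊤ := by
  rw [lt_top_iff_ne_top]
  intro h
  have h₁ : (⊤ : Submodule (MvPolynomial σ k) (MvPolynomial σ k ⧸ J)) =
      Submodule.map J.mkQ ⊤ := by rw [Submodule.map_top, Submodule.range_mkQ]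
  rw [h₁, ← Submodule.map_smul'', smul_eq_mul, Ideal.mul_top] at h
  have h₂ : Submodule.Quotient.mk (1 : MvPolynomial σ k) ∈
      Submodule.map J.mkQ (irrelevantIdeal σ k) := h ▸ ⟨1, trivial, rfl⟩
  obtain ⟨f, hf, h₃⟩ := h₂
  have h₄ := hJ ((Submodule.Quotient.eq J).1 h₃)
  refine one_notMem_irrelevantIdeal (σ := σ) (k := k) ?_
  have := sub_mem hf h₄
  rwa [sub_sub_cancel] at this

/-- Rees' theorem in both directions: a regular sequence longer than $|E|-1$ would kill the nonzero
$\mathrm{Ext}^{|E|-1}$, and vanishing below that degree produces a regular sequence of length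
$|E|-1$. -/
lemma depth_quotient_edgeIdeal [Nonempty E] :
    depth (irrelevantIdeal (E ⊕ E) k)
      (MvPolynomial (E ⊕ E) k ⧸ edgeIdeal k (Finset.univ : Finset E)) =
        ((Fintype.card E - 1 : ℕ) : ℕ∞) := by
  have hpos : 0 < Fintype.card E := Fintype.card_pos
  have hlt := irrelevantIdeal_smul_top_lt
    (edgeIdeal_le_irrelevantIdeal (k := k) (Finset.univ_nonempty (α := E)))
  have hsupp : Module.support (MvPolynomial (E ⊕ E) k)
      (MvPolynomial (E ⊕ E) k ⧸ irrelevantIdeal (E ⊕ E) k) =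
        PrimeSpectrum.zeroLocus (irrelevantIdeal (E ⊕ E) k) := by
    rw [Module.support_eq_zeroLocus, Ideal.annihilator_quotient]
  refine le_antisymm (iSup₂_le fun rs hrs ↦ ?_) ?_
  · by_contra! h
    replace h : Fintype.card E - 1 < rs.length := by exact_mod_cast h
    refine not_extVanishes_quotient_edgeIdeal (k := k) (E := E)
      (j := Fintype.card E - 1) (by omega) ?_
    exact ModuleCat.subsingleton_ext_of_exists_isRegular (irrelevantIdeal (E ⊕ E) k)
      (ModuleCat.of _ (MvPolynomial (E ⊕ E) k ⧸ irrelevantIdeal (E ⊕ E) k)) hsupp.subset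
      (ModuleCat.of _ (MvPolynomial (E ⊕ E) k ⧸ edgeIdeal k (Finset.univ : Finset E)))
      hlt rs hrs.1 hrs.2 _ h
  · obtain ⟨rs, hl, hm, hr⟩ := ModuleCat.exists_isRegular_of_exists_subsingleton_ext
      (irrelevantIdeal (E ⊕ E) k) (Fintype.card E - 1)
      (ModuleCat.of _ (MvPolynomial (E ⊕ E) k ⧸ edgeIdeal k (Finset.univ : Finset E))) hlt
      (ModuleCat.of _ (MvPolynomial (E ⊕ E) k ⧸ irrelevantIdeal (E ⊕ E) k)) hsupp
      (fun i hi ↦ extVanishes_quotient_edgeIdeal_of_lt (by omega))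
    rw [← hl]
    exact le_iSup₂_of_le rs ⟨hm, hr⟩ le_rfl

end Depth

end MonomialCut

namespace MonomialCut

open MvPolynomial

/-! ### Cuts of a tree. -/

section Tree

variable {V : Type*} {G : SimpleGraph V}

lemma cut_compl_iff {A : Set V} {u v : V} (h : G.Adj u v) :
    (⟨s(u, v), h⟩ : G.edgeSet) ∈ cut G A Aᶜ ↔ ¬ (u ∈ A ↔ v ∈ A) := by
  constructor
  · rintro ⟨i, hi, j, hj, h⟩
    rcases Sym2.eq_iff.1 h with ⟨rfl, rfl⟩ | ⟨rfl, rfl⟩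
    · exact fun h' ↦ hj (h'.1 hi)
    · exact fun h' ↦ hj (h'.2 hi)
  · intro h'
    by_cases hu : u ∈ A
    · exact ⟨u, hu, v, fun hv ↦ h' (iff_of_true hu hv), rfl⟩
    · exact ⟨v, by tauto, u, hu, Sym2.eq_swap⟩

/-- Along a walk to `r`, the cut decides at each edge whether the side changes, so it determines the
side of every vertex. -/
lemma eq_of_cut_compl_eq (hG : G.Connected) {A B : Set V} {r : V} (hA : r ∉ A) (hB : r ∉ B)
    (h : cut G A Aᶜ = cut G B Bᶜ) : A = B := by
  ext v
  obtain ⟨p⟩ := hG.preconnected v r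
  induction p with
  | nil => exact iff_of_false hA hB
  | cons hadj _ ih =>
    have h₁ := ih hA hB
    have h₂ := cut_compl_iff (A := A) hadj
    rw [h, cut_compl_iff] at h₂
    tauto

/-- In a tree every set of edges is the cut of a bipartition of the vertices. -/
lemma exists_cut_compl_eq [Fintype V] [Fintype G.edgeSet] (hG : G.IsTree) (D : Set G.edgeSet) :
    ∃ A : Set V, cut G A Aᶜ = D := by
  classical
  obtain ⟨r⟩ := hG.connected.nonempty
  -- Keeping `r` outside `A` removes the ambiguity between `A` and its complement. The map is then
  -- injective between sets of sizes $2^{|V|-1}$ and $2^{|E|}$, equal for a tree, hence surjective.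
  let f : Set {v // v ≠ r} → Set G.edgeSet :=
    fun A ↦ cut G (Subtype.val '' A) (Subtype.val '' A)ᶜ
  have hr : ∀ A : Set {v // v ≠ r}, r ∉ Subtype.val '' A := by
    rintro A ⟨v, -, h⟩
    exact v.2 h
  have hf : Function.Bijective f := by
    rw [Fintype.bijective_iff_injective_and_card]
    refine ⟨fun A B h ↦ Subtype.val_injective.image_injective
      (eq_of_cut_compl_eq hG.connected (hr A) (hr B) h), ?_⟩
    have h₁ := hG.card_edgeFinset
    have h₂ : Fintype.card {v // v ≠ r} = Fintype.card V - 1 := by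
      rw [Fintype.card_subtype_compl, Fintype.card_subtype_eq]
    rw [SimpleGraph.edgeFinset_card] at h₁
    rw [Fintype.card_set, Fintype.card_set, h₂, ← h₁, Nat.add_sub_cancel]
  obtain ⟨A, hA⟩ := hf.surjective D
  exact ⟨_, hA⟩

variable (k : Type*) [Field k]

lemma monomialCutIdeal_eq_edgeIdeal [Fintype V] [Fintype G.edgeSet] (hG : G.IsTree) :
    monomialCutIdeal G k = edgeIdeal k Finset.univ := by
  classical
  rw [monomialCutIdeal, edgeIdeal, Ideal.prod_span]
  congr 1
  ext u
  rw [Set.mem_fintype_prod]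
  have hprod : ∀ A B : Set V, cutMonomial G k A B =
      ∏ e, if e ∈ cut G A B then X (Sum.inl e) else X (Sum.inr e) :=
    fun A B ↦ (Finset.prod_ite _ _).symm
  constructor
  · rintro ⟨A, B, -, -, rfl⟩
    refine ⟨_, fun e ↦ ?_, (hprod A B).symm⟩
    by_cases h : e ∈ cut G A B <;> simp [h]
  · rintro ⟨g, hg, rfl⟩
    -- The cut to realise consists of the edges at which the given generator of the product picks
    -- $s_e$.
    obtain ⟨A, hA⟩ := exists_cut_compl_eq hG {e | g e = X (Sum.inl e)}
    refine ⟨A, Aᶜ, Set.union_compl_self A, Set.inter_compl_self A, ?_⟩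
    rw [hprod, hA]
    refine Finset.prod_congr rfl fun e _ ↦ ?_
    split_ifs with h
    · exact h
    · exact (hg e).resolve_left h

end Tree

end MonomialCut

theorem mainTheorem8 {V : Type*} [Fintype V] (G : SimpleGraph V) [Fintype G.edgeSet]
    (k : Type*) [Field k] (hG : G.IsTree) (hE : G.edgeSet.Nonempty) :
    MonomialCut.HasRegularity (G.edgeSet ⊕ G.edgeSet)
        (MonomialCut.quotientGrading (MonomialCut.monomialCutIdeal G k))
        ((Fintype.card G.edgeSet : ℤ) - 1) ∧
      MonomialCut.depth (MonomialCut.irrelevantIdeal (G.edgeSet ⊕ G.edgeSet) k)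
        (MonomialCut.CutRing G k ⧸ MonomialCut.monomialCutIdeal G k) =
          ((Fintype.card G.edgeSet - 1 : ℕ) : ℕ∞) := by
  have : Nonempty G.edgeSet := hE.to_subtype
  rw [MonomialCut.monomialCutIdeal_eq_edgeIdeal k hG]
  refine ⟨?_, MonomialCut.depth_quotient_edgeIdeal⟩
  obtain ⟨R⟩ := MonomialCut.nonempty_linearResolution_edgeIdeal (k := k)
    (Finset.univ : Finset G.edgeSet)
  exact R.hasRegularity Fintype.card_pos
    (MonomialCut.edgeIdeal_le_irrelevantIdeal Finset.univ_nonempty)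
    (MonomialCut.edgeIdeal_ne_bot _) MonomialCut.homogeneousComponent_mem_edgeIdeal
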